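/- All rings are finite, commutative, with identity. For a prime $p$ and $n,d\ge 1$, $\mathrm{GR}(p^n,d)$ denotes the Galois ring: the local ring (unique up to isomorphism) of characteristic $p^n$ with radical $pR$ and residue field of order $p^d$. **Definitions.** For a subset $X$ of a finite group $G$ put $\xi(X)=\sum_{x\in X}x\in\mathbb ZG$. An *S-ring over a ring $R$* is a subring $\mathcal A$ of the group ring $\mathbb ZR^+$ that has a $\mathbb Z$-basis $\{\xi(X):X\in\mathcal S(\mathcal A)\}$, where $\mathcal S(\mathcal A)$ (the family of *basic sets*) is a partition of $R$ into non-empty sets such that $\{0\}\in\mathcal S(\mathcal A)$, and $-X\in\mathcal S(\mathcal A)$, $uX\in\mathcal S(\mathcal A)$ for all $X\in\mathcal S(\mathcal A)$ and $u\in R^\times$. An *$\mathcal A$-ideal* is an ideal of $R$ that is a union of basic sets. $\mathcal A$ is *dense* if every ideal of $R$ is an $\mathcal A$-ideal. For $X\subset R$ let $I_{\rm L}(X)$ be the largest ideal $I$ of $R$ with $X+I=X$. $\mathcal A$ is *pure* if $I_{\rm L}(X)=0$ for every basic set $X$ meeting $R^\times$. $\mathcal A$ is a *non-trivial generalized wreath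 product* if there are $\mathcal A$-ideals $I\neq R$ and $J\ne 0$ such that $J\subset I_{\rm L}(X)\cap I$ for every basic set $X\subset R\setminus I$. **Theorem.** Let $p\ne q$ be primes and let $d,e$ be positive integers such that $p\mid q^e-1$ and $q\mid p^d-1$. Set $R=R_p\times R_q$, where $R_p=\mathrm{GR}(p^2,d)$ and $R_q=\mathrm{GR}(q^2,e)$. 1. There exists a non-pure dense S-ring over $R$ that is not a non-trivial generalized wreath product. 2. More explicitly, let $\mathcal U_p=1+\mathrm{rad}(R_p)$ and $\mathcal U_q=1+\mathrm{rad}(R_q)$ be the groups of principal units. The Teichmüller group of $R_p$ (the group of $(p^d-1)$-th roots of unity in $R_p$) has a unique subgroup $T_p$ of order $q$, and the Teichmüller group of $R_q$ (the group of $(q^e-1)$-th roots of unity in $R_q$) has a unique subgroup $T_q$ of order $p$. Put $K_p=T_p\,\mathcal U_p$ and $K_q=T_q\,\mathcal U_q$. For a positive integer $m$, say that a subgroup $L\le R^\times=R_p^\times\times R_q^\times$ is a *subdirect product of $K_p$ and $K_q$ over a cyclic group of order $m$* if $L=\{(u,v)\in K_p\times K_q: f_p(u)=f_q(v)\}$ for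 some epimorphisms $f_p:K_p\to L_0$ and $f_q:K_q\to L_0$ onto a cyclic group $L_0$ of order $m$. Then there exist such subdirect products for $m=q$ and for $m=p$. Moreover, for every subdirect product $K_1$ of $K_p$ and $K_q$ over a cyclic group of order $q$, and every subdirect product $K_2$ of $K_p$ and $K_q$ over a cyclic group of order $p$, let $\mathcal S$ be the family consisting of all orbits of $K_1$ on $R^\times$ and all orbits of $K_2$ on $pR\cup qR$ (the groups act by multiplication). Then the $\mathbb Z$-module $\mathcal A=\mathrm{Span}_{\mathbb Z}\{\xi(X):X\in\mathcal S\}$ is an S-ring over $R$ with family of basic sets $\mathcal S$; it is dense, it is not pure, and it is not a non-trivial generalized wreath product. -/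

import Mathlib

open scoped Pointwise

/-- The element `ξ(X) = ∑_{x ∈ X} x` of the integral group ring `ℤG` of a finite (additively
written) group `G`. -/
noncomputable def xi {G : Type*} [Finite G] (X : Set G) : AddMonoidAlgebra ℤ G :=
  ∑ x ∈ X.toFinite.toFinset, AddMonoidAlgebra.single x (1 : ℤ)

/-- A Schur ring over a finite, additively written, group `G`: a subring of `ℤG` together with
its family of basic sets, which is a partition of `G` into non-empty sets containing `{0}` and
closed under `X ↦ -X`, such that the elements `ξ(X)`, `X` a basic set, form a `ℤ`-basis of the
subring. (The linear independence of the `ξ(X)` is automatic, since the basic sets are non-empty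
and pairwise disjoint.) -/
structure SchurRing (G : Type*) [AddGroup G] [Finite G] where
  toSubring : Subring (AddMonoidAlgebra ℤ G)
  basicSets : Set (Set G)
  isPartition : Setoid.IsPartition basicSets
  zero_mem : {0} ∈ basicSets
  neg_mem : ∀ X ∈ basicSets, -X ∈ basicSets
  coe_eq_span : (toSubring : Set (AddMonoidAlgebra ℤ G)) = Submodule.span ℤ (xi '' basicSets)

/-- A Schur ring over a finite commutative ring `R`: a Schur ring over the additive group of `R`
that is invariant under multiplication by the units of `R`. -/
structure SchurRingOver (R : Type*) [CommRing R] [Finite R] extends SchurRing R where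
  smul_mem : ∀ (u : Rˣ), ∀ X ∈ basicSets, u • X ∈ basicSets

/-- The largest ideal `I` of `R` such that `X + I = X`. -/
def lowerIdeal {R : Type*} [CommRing R] (X : Set R) : Ideal R :=
  sSup {I : Ideal R | X + (I : Set R) = X}

/-- `lowerIdeal X` is indeed the largest ideal `I` with `X + I = X`. -/
theorem isGreatest_lowerIdeal {R : Type*} [CommRing R] (X : Set R) :
    IsGreatest {I : Ideal R | X + (I : Set R) = X} (lowerIdeal X) := by
  refine ⟨?_, fun I hI => le_sSup hI⟩
  have key : ∀ r ∈ lowerIdeal X, ∀ x ∈ X, x + r ∈ X := by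
    intro r hr
    unfold lowerIdeal at hr
    rw [sSup_eq_iSup'] at hr
    induction hr using Submodule.iSup_induction' with
    | mem I r hr =>
      intro x hx
      have h : X + ((I : Ideal R) : Set R) = X := I.2
      rw [← h]
      exact Set.add_mem_add hx hr
    | zero => intro x hx; simpa using hx
    | add a b _ _ ha hb =>
      intro x hx
      rw [← add_assoc]
      exact hb _ (ha _ hx)
  apply Set.Subset.antisymm
  · rintro _ ⟨x, hx, r, hr, rfl⟩
    exact key r hr x hx
  · intro x hx
    exact ⟨x, hx, 0, (lowerIdeal X).zero_mem, add_zero x⟩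

namespace SchurRingOver

variable {R : Type*} [CommRing R] [Finite R]

/-- `Y` is a union of basic sets. -/
def IsASet (A : SchurRingOver R) (Y : Set R) : Prop :=
  ∃ F : Set (Set R), F ⊆ A.basicSets ∧ Y = ⋃₀ F

/-- The ideal `I` is a union of basic sets. -/
def IsAIdeal (A : SchurRingOver R) (I : Ideal R) : Prop :=
  A.IsASet (I : Set R)

/-- Every ideal of `R` is an `A`-ideal. -/
def IsDense (A : SchurRingOver R) : Prop :=
  ∀ I : Ideal R, A.IsAIdeal I

/-- The ideal `lowerIdeal X` is zero for the basic sets `X` that meet the unit group (these basic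
sets are permuted transitively by the unit group and so have the same `lowerIdeal X`). -/
def IsPure (A : SchurRingOver R) : Prop :=
  ∀ X ∈ A.basicSets, (∃ x ∈ X, IsUnit x) → lowerIdeal X = ⊥

/-- `A` is a non-trivial generalized wreath product: there are `A`-ideals `I` and `J`, with
`I ≠ R` and `J ≠ 0`, such that `J ⊆ lowerIdeal X ∩ I` for every basic set `X ⊆ R \ I`. As such
an `X` exists when `I ≠ R`, these conditions imply `0 ≠ J ⊆ I ≠ R`, so both ideals are proper
and non-zero. -/
def IsNontrivialGenWreath (A : SchurRingOver R) : Prop :=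
  ∃ I J : Ideal R, A.IsAIdeal I ∧ A.IsAIdeal J ∧ I ≠ ⊤ ∧ J ≠ ⊥ ∧
    ∀ X ∈ A.basicSets, X ⊆ (I : Set R)ᶜ → J ≤ lowerIdeal X ⊓ I

end SchurRingOver

/-- `R` is the Galois ring `GR(p^n, d)`: a finite commutative local ring of characteristic `p^n`,
with radical `pR` and with residue field of order `p^d`. -/
structure IsGaloisRing (R : Type*) [CommRing R] [Finite R] [IsLocalRing R] (p n d : ℕ) :
    Prop where
  charP : CharP R (p ^ n)
  maximalIdeal_eq : IsLocalRing.maximalIdeal R = Ideal.span {(p : R)}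
  card_residueField : Nat.card (IsLocalRing.ResidueField R) = p ^ d

/-- The group `1 + rad(R)` of principal units of a local ring. -/
noncomputable def principalUnits (R : Type*) [CommRing R] [IsLocalRing R] : Subgroup Rˣ :=
  (Units.map (IsLocalRing.residue R : R →* IsLocalRing.ResidueField R)).ker

/-- The Teichmüller group of a Galois ring: the roots of unity in `R` of degree `|k| - 1`, where
`k` is the residue field. (The unit group is the direct product of a cyclic group of this order
and of the `p`-group of principal units.) -/
noncomputable def teichmullerGroup (R : Type*) [CommRing R] [IsLocalRing R] : Subgroup Rˣ :=
  rootsOfUnity (Nat.card (IsLocalRing.ResidueField R) - 1) R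

/-- `L` is a subdirect product of `K₁ ≤ R₁ˣ` and `K₂ ≤ R₂ˣ` over a cyclic group of order `m`:
there are epimorphisms `f₁` and `f₂` from `K₁` and `K₂` onto a cyclic group of order `m` with
`L = {(u, v) ∈ K₁ × K₂ : f₁ u = f₂ v}`. Here `MulEquiv.prodUnits` identifies `(R₁ × R₂)ˣ` with
`R₁ˣ × R₂ˣ`, and every cyclic group of order `m` is isomorphic to `ZMod m`. -/
def IsSubdirectOver {R₁ R₂ : Type*} [CommRing R₁] [CommRing R₂] (m : ℕ)
    (K₁ : Subgroup R₁ˣ) (K₂ : Subgroup R₂ˣ) (L : Subgroup (R₁ × R₂)ˣ) : Prop :=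
  ∃ (f₁ : K₁ →* Multiplicative (ZMod m)) (f₂ : K₂ →* Multiplicative (ZMod m)),
    Function.Surjective f₁ ∧ Function.Surjective f₂ ∧
    ∀ w : (R₁ × R₂)ˣ, w ∈ L ↔
      ∃ (hu : (MulEquiv.prodUnits w).1 ∈ K₁) (hv : (MulEquiv.prodUnits w).2 ∈ K₂),
        f₁ ⟨_, hu⟩ = f₂ ⟨_, hv⟩

/-- The set of orbits, on elements of `M`, of the group `K ≤ Rˣ` acting by multiplication. -/
def orbitsOn {R : Type*} [CommRing R] (K : Subgroup Rˣ) (M : Set R) : Set (Set R) :=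
  (fun x : R => MulAction.orbit K x) '' M

/-- The family consisting of the orbits of `K₁` on `Rˣ` and the orbits of `K₂` on `pR ∪ qR`. -/
def gluedOrbits {R : Type*} [CommRing R] (p q : ℕ) (K₁ K₂ : Subgroup Rˣ) : Set (Set R) :=
  orbitsOn K₁ {x : R | IsUnit x} ∪
    orbitsOn K₂ ((Ideal.span {(p : R)} : Set R) ∪ (Ideal.span {(q : R)} : Set R))

/-! Write `A`, `B` for the two Galois rings and `K₀` for the product of the groups K_p and K_q.
Multiplication in the group ring is convolution of coefficient functions, and the span of the ξ(X)
consists of the functions constant on basic sets. So the S-ring property says that glued functions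
(`K₁`-invariant on units, `K₂`-invariant elsewhere) are closed under convolution.

Principal units of `A` are killed by p, those of `B` by q, while T_p has order q and T_q order p.
Hence a map onto a group of order q kills the principal units of `A` and T_q, and a map onto a group
of order p kills the principal units of `B` and T_p. So `K₁` contains the principal units of `A` and
`K₂` those of `B`. Both groups project onto the factors of `K₀`. As the radicals square to zero,
`K₂` has the orbits of `K₀` on rad(A) × B, and `K₁` has them on A × rad(B).

A glued function splits (`exists_decomposition`) according to support: on units it is periodic
modulo rad(A) × 0; on rad(A) × Bˣ it is `K₀`-invariant and periodic modulo 0 × rad(B); on A × rad(B)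
it is just `K₂`-invariant. Convolving with a periodic function permits averaging the other factor
over the period (`card_mul_conv`), and this averaging upgrades `K₂`-invariance to `K₀`-invariance
where needed.

Impurity comes from the principal units of `A` inside `K₁`. A wreath decomposition fails because
`K₁` omits some principal unit of `B`, and `K₂` omits all pairs of principal units above some
principal unit of `A`. -/

/-! ### Convolution of functions on a finite group -/

/-- The convolution of two integer-valued functions on a finite additive group. -/
noncomputable def conv {G : Type*} [AddCommGroup G] [Finite G] (f g : G → ℤ) (x : G) : ℤ :=
  letI := Fintype.ofFinite G
  ∑ y, f y * g (x - y)

section Conv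

variable {G : Type*} [AddCommGroup G] [Finite G]

theorem conv_eq_sum [Fintype G] (f g : G → ℤ) (x : G) : conv f g x = ∑ y, f y * g (x - y) := by
  unfold conv
  congr!

theorem AddMonoidAlgebra.coeff_mul_eq_conv (a b : AddMonoidAlgebra ℤ G) (x : G) :
    (a * b).coeff x = conv a.coeff b.coeff x := by
  classical
  cases nonempty_fintype G
  rw [conv_eq_sum, AddMonoidAlgebra.mul_def]
  simp only [Finsupp.sum_fintype, AddMonoidAlgebra.single_zero, zero_mul, mul_zero,
    Finset.sum_const_zero, implies_true, AddMonoidAlgebra.coeff_sum, Finsupp.finsetSum_apply,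
    AddMonoidAlgebra.coeff_single, Finsupp.single_apply]
  refine Finset.sum_congr rfl fun y _ => ?_
  simp only [← eq_sub_iff_add_eq']
  simp

theorem conv_comm (f g : G → ℤ) : conv f g = conv g f := by
  cases nonempty_fintype G
  funext x
  rw [conv_eq_sum, conv_eq_sum]
  refine Fintype.sum_equiv (Equiv.subLeft x) _ _ fun y => ?_
  simp [mul_comm]

theorem conv_add (f g h : G → ℤ) : conv f (g + h) = conv f g + conv f h := by
  cases nonempty_fintype G
  funext x
  simp [conv_eq_sum, mul_add, Finset.sum_add_distrib]

theorem add_conv (f g h : G → ℤ) : conv (f + g) h = conv f h + conv g h := by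
  rw [conv_comm, conv_add, conv_comm h f, conv_comm h g]

/-- The sum of the translates of `f` by the elements of a subgroup. -/
noncomputable def cosetSum (H : AddSubgroup G) (f : G → ℤ) (x : G) : ℤ :=
  letI := Fintype.ofFinite H
  ∑ z : H, f (x + z)

theorem cosetSum_eq_sum (H : AddSubgroup G) [Fintype H] (f : G → ℤ) (x : G) :
    cosetSum H f x = ∑ z : H, f (x + z) := by
  unfold cosetSum
  congr!

theorem cosetSum_add_mem (H : AddSubgroup G) (f : G → ℤ) (x : G) {z : G} (hz : z ∈ H) :
    cosetSum H f (x + z) = cosetSum H f x := by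
  cases nonempty_fintype H
  rw [cosetSum_eq_sum, cosetSum_eq_sum]
  refine Fintype.sum_equiv (Equiv.addLeft ⟨z, hz⟩) _ _ fun y => ?_
  simp [add_assoc]

theorem conv_add_mem {H : AddSubgroup G} {f g : G → ℤ} (hf : ∀ z ∈ H, ∀ x, f (x + z) = f x)
    {z : G} (hz : z ∈ H) (x : G) : conv f g (x + z) = conv f g x := by
  cases nonempty_fintype G
  rw [conv_comm, conv_eq_sum, conv_eq_sum]
  refine Finset.sum_congr rfl fun y _ => ?_
  rw [add_sub_right_comm, hf z hz]

/-- Translating `g` by an element of the period group of `f` does not change the convolution; sum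
over all translations. The factor |H| keeps the average of `g` integral. -/
theorem card_mul_conv {H : AddSubgroup G} {f : G → ℤ} (hf : ∀ z ∈ H, ∀ x, f (x + z) = f x)
    (g : G → ℤ) (x : G) : Nat.card H * conv f g x = conv f (cosetSum H g) x := by
  cases nonempty_fintype G
  cases nonempty_fintype H
  have key : ∀ z : H, conv f g x = ∑ y, f y * g (x - y + z) := by
    intro z
    rw [conv_eq_sum]
    refine Fintype.sum_equiv (Equiv.addRight (z : G)) _ _ fun y => ?_
    simp only [Equiv.coe_addRight]
    rw [hf z z.2]
    congr 2
    abel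
  rw [conv_eq_sum f (cosetSum H g)]
  simp only [cosetSum_eq_sum, Finset.mul_sum]
  rw [Finset.sum_comm]
  simp only [← key]
  simp [Nat.card_eq_fintype_card]

end Conv

/-! ### Functions invariant under a group of units -/

section Invariance

variable {R : Type*} [CommRing R]

/-- The function `f` is constant on the orbits of `K`. -/
def UnitInvariant (K : Subgroup Rˣ) (f : R → ℤ) : Prop :=
  ∀ w ∈ K, ∀ x, f (w * x) = f x

theorem UnitInvariant.mono {K L : Subgroup Rˣ} (h : K ≤ L) {f : R → ℤ} (hf : UnitInvariant L f) :
    UnitInvariant K f := fun w hw => hf w (h hw)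

theorem UnitInvariant.conv [Finite R] {K : Subgroup Rˣ} {f g : R → ℤ} (hf : UnitInvariant K f)
    (hg : UnitInvariant K g) : UnitInvariant K (conv f g) := by
  cases nonempty_fintype R
  intro w hw x
  rw [conv_eq_sum, conv_eq_sum]
  symm
  refine Fintype.sum_equiv (Units.mulLeft w) _ _ fun y => ?_
  simp only [Units.mulLeft_apply]
  rw [← mul_sub, hf w hw, hg w hw]

theorem UnitInvariant.of_mul {K : Subgroup Rˣ} {f : R → ℤ} {n : ℤ} (hn : n ≠ 0)
    (h : UnitInvariant K fun x => n * f x) : UnitInvariant K f := fun w hw x =>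
  mul_left_cancel₀ hn (h w hw x)

theorem UnitInvariant.cosetSum [Finite R] {K : Subgroup Rˣ} {f : R → ℤ} (hf : UnitInvariant K f)
    (I : Ideal R) : UnitInvariant K (cosetSum I.toAddSubgroup f) := by
  intro w hw x
  cases nonempty_fintype I.toAddSubgroup
  rw [cosetSum_eq_sum, cosetSum_eq_sum]
  symm
  let e : I.toAddSubgroup ≃ I.toAddSubgroup :=
    { toFun := fun z => ⟨w * z, I.mul_mem_left _ z.2⟩
      invFun := fun z => ⟨(w⁻¹ : Rˣ) * z, I.mul_mem_left _ z.2⟩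
      left_inv := fun z => by ext; simp
      right_inv := fun z => by ext; simp }
  refine Fintype.sum_equiv e _ _ fun y => ?_
  rw [← hf w hw, mul_add]
  rfl

end Invariance

/-! ### Gluing of invariant functions -/

open IsLocalRing

/-- The function `f` is `K₁`-invariant on the units and `K₂`-invariant on the non-units. -/
structure IsGlued {R : Type*} [CommRing R] (K₁ K₂ : Subgroup Rˣ) (f : R → ℤ) : Prop where
  unit : ∀ w ∈ K₁, ∀ x, IsUnit x → f (w * x) = f x
  nonunit : ∀ w ∈ K₂, ∀ x, ¬ IsUnit x → f (w * x) = f x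

theorem IsGlued.add {R : Type*} [CommRing R] {K₁ K₂ : Subgroup Rˣ} {f g : R → ℤ}
    (hf : IsGlued K₁ K₂ f) (hg : IsGlued K₁ K₂ g) : IsGlued K₁ K₂ (f + g) where
  unit w hw x hx := by simp [hf.unit w hw x hx, hg.unit w hw x hx]
  nonunit w hw x hx := by simp [hf.nonunit w hw x hx, hg.nonunit w hw x hx]

/-- Conditions on `K₁, K₂ ≤ K₀` under which the functions glued from `K₁`- and `K₂`-invariant
functions are closed under convolution. -/
structure IsGluingPair {A B : Type*} [CommRing A] [IsLocalRing A] [CommRing B] [IsLocalRing B]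
    (K₀ K₁ K₂ : Subgroup (A × B)ˣ) : Prop where
  le₁ : K₁ ≤ K₀
  le₂ : K₂ ≤ K₀
  mem₁ : ∀ w : (A × B)ˣ, w.1.1 - 1 ∈ maximalIdeal A → w.1.2 = 1 → w ∈ K₁
  mem₂ : ∀ w : (A × B)ˣ, w.1.1 = 1 → w.1.2 - 1 ∈ maximalIdeal B → w ∈ K₂
  lift₁ : ∀ w ∈ K₀, ∃ v ∈ K₁, v.1.2 = w.1.2
  lift₂ : ∀ w ∈ K₀, ∃ v ∈ K₂, v.1.1 = w.1.1
  approx₁ : ∀ w ∈ K₀, ∃ v ∈ K₁, v.1.1 = w.1.1 ∧ v.1.2 - w.1.2 ∈ maximalIdeal B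
  approx₂ : ∀ w ∈ K₀, ∃ v ∈ K₂, v.1.1 - w.1.1 ∈ maximalIdeal A ∧ v.1.2 = w.1.2

namespace IsGluingPair

variable {A B : Type*} [CommRing A] [IsLocalRing A] [CommRing B] [IsLocalRing B]

/-- The ideal `rad(A) × 0`. -/
abbrev radLeft (A B : Type*) [CommRing A] [IsLocalRing A] [CommRing B] : Ideal (A × B) :=
  Ideal.prod (maximalIdeal A) ⊥

/-- The ideal `0 × rad(B)`. -/
abbrev radRight (A B : Type*) [CommRing A] [CommRing B] [IsLocalRing B] : Ideal (A × B) :=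
  Ideal.prod ⊥ (maximalIdeal B)

/-- The function `f` is constant on the cosets of `I`. -/
def TransInvariant {R : Type*} [CommRing R] (I : Ideal R) (f : R → ℤ) : Prop :=
  ∀ z ∈ I.toAddSubgroup, ∀ x, f (x + z) = f x

theorem TransInvariant.congr {R : Type*} [CommRing R] {I : Ideal R} {f : R → ℤ}
    (hf : TransInvariant I f) {x y : R} (h : x - y ∈ I) : f x = f y := by
  rw [← hf (x - y) h y, add_sub_cancel]

theorem mul_eq_of_sub_mem {A : Type*} [CommRing A] [IsLocalRing A]
    (hA : ∀ x ∈ maximalIdeal A, ∀ y ∈ maximalIdeal A, x * y = 0) {u v x : A}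
    (h : u - v ∈ maximalIdeal A) (hx : x ∈ maximalIdeal A) : u * x = v * x := by
  rw [← sub_eq_zero, ← sub_mul]
  exact hA _ h _ hx

theorem isUnit_add_iff {R : Type*} [CommRing R] [IsLocalRing R] {a z : R}
    (hz : z ∈ maximalIdeal R) : IsUnit (a + z) ↔ IsUnit a := by
  rw [← not_iff_not]
  exact (maximalIdeal R).add_mem_iff_left hz

/-- Since a + z = (1 + a⁻¹z)a, a coset of the radical consisting of units lies in one orbit of the
principal units. This turns multiplicative invariance into periodicity. -/
theorem exists_unit_mul_eq_add {R : Type*} [CommRing R] [IsLocalRing R] {a z : R}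
    (ha : IsUnit a) (hz : z ∈ maximalIdeal R) :
    ∃ u : Rˣ, (u : R) - 1 ∈ maximalIdeal R ∧ u * a = a + z := by
  obtain ⟨a, rfl⟩ := ha
  obtain ⟨b, hb⟩ := (isUnit_add_iff hz).2 a.isUnit
  refine ⟨b * a⁻¹, ?_, by simp [hb]⟩
  have : ((b * a⁻¹ : Rˣ) : R) - 1 = (a⁻¹ : Rˣ) * z := by
    rw [Units.val_mul, hb, add_mul, Units.mul_inv]
    ring
  rw [this]
  exact Ideal.mul_mem_left _ _ hz

variable {K₀ K₁ K₂ : Subgroup (A × B)ˣ}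
  (hA : ∀ x ∈ maximalIdeal A, ∀ y ∈ maximalIdeal A, x * y = 0)
  (hB : ∀ x ∈ maximalIdeal B, ∀ y ∈ maximalIdeal B, x * y = 0)

/-! ### Comparison of the orbits of `K₀`, `K₁` and `K₂` -/

section

variable (h : IsGluingPair K₀ K₁ K₂) {f g : A × B → ℤ}

include h

theorem isGlued_of_unitInvariant (hf : UnitInvariant K₀ f) : IsGlued K₁ K₂ f where
  unit w hw x _ := hf w (h.le₁ hw) x
  nonunit w hw x _ := hf w (h.le₂ hw) x

include hA in
-- On rad(A) a unit acts through its residue, so the first coordinate of `w` matters only modulo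
-- rad(A).
theorem exists_mul_eq_of_fst_mem {w : (A × B)ˣ} (hw : w ∈ K₀) {x : A × B}
    (hx : x.1 ∈ maximalIdeal A) : ∃ v ∈ K₂, (w * x : A × B) = v * x := by
  obtain ⟨v, hv, h1, h2⟩ := h.approx₂ w hw
  exact ⟨v, hv, Prod.ext (mul_eq_of_sub_mem hA h1 hx).symm (by simp [h2])⟩

include hB in
theorem exists_mul_eq_of_snd_mem {w : (A × B)ˣ} (hw : w ∈ K₀) {x : A × B}
    (hx : x.2 ∈ maximalIdeal B) : ∃ v ∈ K₁, (w * x : A × B) = v * x := by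
  obtain ⟨v, hv, h1, h2⟩ := h.approx₁ w hw
  exact ⟨v, hv, Prod.ext (by simp [h1]) (mul_eq_of_sub_mem hB h2 hx).symm⟩

include hB in
-- A non-unit either has first coordinate in rad(A), where periodicity lets that coordinate be
-- replaced by 0 and only the projection of `K₁` to `B` matters, or lies in A × rad(B), where `K₁`
-- and `K₀` have the same orbits.
theorem isGlued_of_transInvariant (hf : UnitInvariant K₁ f)
    (hf' : TransInvariant (radLeft A B) f) : IsGlued K₁ K₂ f where
  unit w hw x _ := hf w hw x
  nonunit w hw x hx := by
    by_cases hx1 : x.1 ∈ maximalIdeal A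
    · obtain ⟨v, hv, hvw⟩ := h.lift₁ w (h.le₂ hw)
      have e : ∀ a ∈ maximalIdeal A, ∀ b : B, f (a, b) = f (0, b) := fun a ha b =>
        hf'.congr ⟨by simpa using ha, by simp⟩
      have := hf v hv (0, x.2)
      rw [show ((v : A × B) * (0, x.2) : A × B) = (0, w.1.2 * x.2) from
        Prod.ext (by simp) (by simp [hvw])] at this
      rw [show x = (x.1, x.2) from rfl, e _ hx1, ← this]
      exact e _ (Ideal.mul_mem_left _ _ hx1) _
    · have hx2 : x.2 ∈ maximalIdeal B := by
        rw [mem_maximalIdeal, mem_nonunits_iff]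
        rw [mem_maximalIdeal, mem_nonunits_iff, not_not] at hx1
        exact fun h2 => hx (Prod.isUnit_iff.2 ⟨hx1, h2⟩)
      obtain ⟨v, hv, e⟩ := h.exists_mul_eq_of_snd_mem hB (h.le₂ hw) hx2
      rw [e, hf v hv]

theorem unitInvariant_of_transInvariant (hf : UnitInvariant K₂ f)
    (hf' : TransInvariant (radLeft A B) f) : UnitInvariant K₀ f := by
  intro w hw x
  obtain ⟨v, hv, h1, h2⟩ := h.approx₂ w hw
  rw [← hf v hv x]
  refine hf'.congr ⟨?_, by simp [h2]⟩
  have : w.1.1 - v.1.1 ∈ maximalIdeal A := by rw [← neg_sub]; exact neg_mem h1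
  simpa [sub_mul] using Ideal.mul_mem_right x.1 _ this

/-- On the support the second coordinate can be replaced by 0, so only the projection of `K₂` to `A`
matters, and it covers that of `K₀`. -/
theorem unitInvariant_of_transInvariant_of_support (hf : UnitInvariant K₂ f)
    (hf' : TransInvariant (radRight A B) f) (hs : ∀ x, IsUnit x.2 → f x = 0) :
    UnitInvariant K₀ f := by
  intro w hw x
  by_cases hx : IsUnit x.2
  · rw [hs _ hx, hs]
    exact (Prod.isUnit_iff.1 w.isUnit).2.mul hx
  · have hx' : x.2 ∈ maximalIdeal B := hx
    have e : ∀ a : A, ∀ b ∈ maximalIdeal B, f (a, b) = f (a, 0) := fun a b hb =>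
      hf'.congr ⟨by simp, by simpa using hb⟩
    obtain ⟨v, hv, hvw⟩ := h.lift₂ w hw
    have := hf v hv (x.1, 0)
    rw [show ((v : A × B) * (x.1, 0) : A × B) = (w.1.1 * x.1, 0) from
      Prod.ext (by simp [hvw]) (by simp)] at this
    rw [show x = (x.1, x.2) from rfl, e _ _ hx', ← this]
    exact e _ _ (Ideal.mul_mem_left _ _ hx')

/-! ### Convolutions of the pieces of a glued function -/

variable [Finite A] [Finite B]

include hB in
-- Averaging `g` over rad(A) × 0 makes it `K₀`-invariant, hence `K₁`-invariant; the convolution is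
-- then `K₁`-invariant and inherits the period of `f`.
theorem isGlued_conv_of_transInvariant (hf : UnitInvariant K₁ f)
    (hf' : TransInvariant (radLeft A B) f) (hg : UnitInvariant K₂ g) :
    IsGlued K₁ K₂ (conv f g) := by
  refine h.isGlued_of_transInvariant hB ?_ fun z hz x => conv_add_mem hf' hz x
  refine .of_mul (n := (Nat.card (radLeft A B).toAddSubgroup : ℤ))
    (by exact_mod_cast Nat.card_pos.ne') ?_
  simp only [card_mul_conv hf']
  exact hf.conv ((h.unitInvariant_of_transInvariant (hg.cosetSum _)
    fun z hz x => cosetSum_add_mem _ _ _ hz).mono h.le₁)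

/-- Averaging `g` over 0 × rad(B) preserves its support condition and makes it `K₀`-invariant, so
the whole convolution is `K₀`-invariant. -/
theorem isGlued_conv_of_support (hf : UnitInvariant K₀ f)
    (hf' : TransInvariant (radRight A B) f) (hg : UnitInvariant K₂ g)
    (hs : ∀ x, IsUnit x.2 → g x = 0) : IsGlued K₁ K₂ (conv f g) := by
  refine h.isGlued_of_unitInvariant ?_
  refine .of_mul (n := (Nat.card (radRight A B).toAddSubgroup : ℤ))
    (by exact_mod_cast Nat.card_pos.ne') ?_
  simp only [card_mul_conv hf']
  refine hf.conv (h.unitInvariant_of_transInvariant_of_support (hg.cosetSum _)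
    (fun z hz x => cosetSum_add_mem _ _ _ hz) fun x hx => ?_)
  cases nonempty_fintype (radRight A B).toAddSubgroup
  rw [cosetSum_eq_sum]
  refine Finset.sum_eq_zero fun z _ => hs _ ?_
  by_contra hc
  have hz : (z : A × B).2 ∈ maximalIdeal B := z.2.2
  have := sub_mem (show (x + z : A × B).2 ∈ maximalIdeal B from hc) hz
  simp at this
  exact this hx

omit h [IsLocalRing A] in
-- A × rad(B) is closed under addition, so the convolution vanishes on units and `K₂`-invariance
-- suffices.
theorem isGlued_conv_of_support_support (hf : UnitInvariant K₂ f) (hg : UnitInvariant K₂ g)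
    (hs : ∀ x, IsUnit x.2 → f x = 0) (hs' : ∀ x, IsUnit x.2 → g x = 0) :
    IsGlued K₁ K₂ (conv f g) := by
  have key : ∀ x : A × B, IsUnit x.2 → conv f g x = 0 := by
    intro x hx
    cases nonempty_fintype (A × B)
    rw [conv_eq_sum]
    refine Finset.sum_eq_zero fun y _ => ?_
    by_cases hy : IsUnit y.2
    · rw [hs _ hy, zero_mul]
    · rw [hs', mul_zero]
      by_contra hc
      have := add_mem (show (x - y).2 ∈ maximalIdeal B from hc)
        (show y.2 ∈ maximalIdeal B from hy)
      simp at this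
      exact this hx
  refine ⟨fun w _ x hx => ?_, fun w hw x _ => hf.conv hg w hw x⟩
  rw [key _ (Prod.isUnit_iff.1 hx).2, key _ (Prod.isUnit_iff.1 (w.isUnit.mul hx)).2]

omit [Finite A] [Finite B]

include hA in
theorem exists_decomposition (hf : IsGlued K₁ K₂ f) : ∃ f₁ f₂ f₃ : A × B → ℤ,
    (UnitInvariant K₁ f₁ ∧ TransInvariant (radLeft A B) f₁) ∧
    (UnitInvariant K₀ f₂ ∧ TransInvariant (radRight A B) f₂) ∧
    (UnitInvariant K₂ f₃ ∧ ∀ x, IsUnit x.2 → f₃ x = 0) ∧ f = f₁ + (f₂ + f₃) := by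
  classical
  have hu : ∀ (w : (A × B)ˣ) (x : A × B), IsUnit (w * x : A × B).1 ↔ IsUnit x.1 := fun w x => by
    simp [(Prod.isUnit_iff.1 w.isUnit).1]
  have hu' : ∀ (w : (A × B)ˣ) (x : A × B), IsUnit (w * x : A × B).2 ↔ IsUnit x.2 := fun w x => by
    simp [(Prod.isUnit_iff.1 w.isUnit).2]
  -- The pieces are the restrictions of `f` to Aˣ × Bˣ, rad(A) × Bˣ and A × rad(B).
  refine ⟨fun x => if IsUnit x.1 ∧ IsUnit x.2 then f x else 0,
    fun x => if ¬ IsUnit x.1 ∧ IsUnit x.2 then f x else 0,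
    fun x => if IsUnit x.2 then 0 else f x, ⟨?_, ?_⟩, ⟨?_, ?_⟩, ⟨?_, ?_⟩, ?_⟩
  · intro w hw x
    simp only [hu, hu']
    split_ifs with hx
    · exact hf.unit w hw x (Prod.isUnit_iff.2 hx)
    · rfl
  · intro z hz x
    obtain ⟨hz1, hz2⟩ : z.1 ∈ maximalIdeal A ∧ z.2 = 0 := hz
    have e1 : IsUnit (x + z).1 ↔ IsUnit x.1 := isUnit_add_iff hz1
    have e2 : (x + z).2 = x.2 := by simp [hz2]
    simp only [e1, e2]
    split_ifs with hx
    · obtain ⟨u, hu1, hu2⟩ := exists_unit_mul_eq_add hx.1 hz1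
      rw [← hf.unit (MulEquiv.prodUnits.symm (u, 1)) (h.mem₁ _ hu1 rfl) x (Prod.isUnit_iff.2 hx)]
      congr 1
      exact Prod.ext hu2.symm (e2.trans (one_mul _).symm)
    · rfl
  · intro w hw x
    simp only [hu, hu']
    split_ifs with hx
    · obtain ⟨v, hv, e⟩ := h.exists_mul_eq_of_fst_mem hA hw (x := x) hx.1
      rw [e]
      exact hf.nonunit v hv x fun hc => hx.1 (Prod.isUnit_iff.1 hc).1
    · rfl
  · intro z hz x
    obtain ⟨hz1, hz2⟩ : z.1 = 0 ∧ z.2 ∈ maximalIdeal B := hz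
    have e1 : (x + z).1 = x.1 := by simp [hz1]
    have e2 : IsUnit (x + z).2 ↔ IsUnit x.2 := isUnit_add_iff hz2
    simp only [e1, e2]
    split_ifs with hx
    · obtain ⟨u, hu1, hu2⟩ := exists_unit_mul_eq_add hx.2 hz2
      rw [← hf.nonunit (MulEquiv.prodUnits.symm (1, u)) (h.mem₂ _ rfl hu1) x
        fun hc => hx.1 (Prod.isUnit_iff.1 hc).1]
      congr 1
      exact Prod.ext (e1.trans (one_mul _).symm) hu2.symm
    · rfl
  · intro w hw x
    simp only [hu']
    split_ifs with hx
    · rfl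
    · exact hf.nonunit w hw x fun hc => hx (Prod.isUnit_iff.1 hc).2
  · intro x hx
    simp [hx]
  · funext x
    simp only [Pi.add_apply]
    split_ifs <;> simp_all

include hA hB in
/-- Glued functions are closed under convolution. -/
theorem isGlued_conv [Finite A] [Finite B] (hf : IsGlued K₁ K₂ f) (hg : IsGlued K₁ K₂ g) :
    IsGlued K₁ K₂ (conv f g) := by
  obtain ⟨f₁, f₂, f₃, ⟨hf1, hf1'⟩, ⟨hf2, hf2'⟩, ⟨hf3, hf3'⟩, rfl⟩ := h.exists_decomposition hA hf
  obtain ⟨g₁, g₂, g₃, ⟨hg1, hg1'⟩, ⟨hg2, hg2'⟩, ⟨hg3, hg3'⟩, rfl⟩ := h.exists_decomposition hA hg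
  simp only [conv_add, add_conv]
  refine .add (.add ?_ (.add ?_ ?_)) (.add (.add ?_ (.add ?_ ?_)) (.add ?_ (.add ?_ ?_)))
  · exact h.isGlued_of_transInvariant hB (hf1.conv hg1) fun z hz x => conv_add_mem hf1' hz x
  · rw [conv_comm]
    exact h.isGlued_conv_of_transInvariant hB hg1 hg1' (hf2.mono h.le₂)
  · rw [conv_comm]
    exact h.isGlued_conv_of_transInvariant hB hg1 hg1' hf3
  · exact h.isGlued_conv_of_transInvariant hB hf1 hf1' (hg2.mono h.le₂)
  · exact h.isGlued_of_unitInvariant (hf2.conv hg2)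
  · rw [conv_comm]
    exact h.isGlued_conv_of_support hg2 hg2' hf3 hf3'
  · exact h.isGlued_conv_of_transInvariant hB hf1 hf1' hg3
  · exact h.isGlued_conv_of_support hf2 hf2' hg3 hg3'
  · exact isGlued_conv_of_support_support hf3 hg3 hf3' hg3'

end

end IsGluingPair

/-! ### Schur rings from partitions into orbits -/

section Partition

variable {G : Type*} [Finite G]

theorem coeff_xi (X : Set G) (x : G) [Decidable (x ∈ X)] :
    (xi X).coeff x = if x ∈ X then 1 else 0 := by
  classical
  simp [xi, Finsupp.single_apply]

/-- The ξ(X) are indicator functions of disjoint sets, so a function constant on each part is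
recovered from its values at chosen representatives. -/
theorem mem_span_xi_iff [Nonempty G] {c : Set (Set G)} (hc : Setoid.IsPartition c)
    (f : AddMonoidAlgebra ℤ G) : f ∈ Submodule.span ℤ (xi '' c) ↔
      ∀ X ∈ c, ∀ x ∈ X, ∀ y ∈ X, f.coeff x = f.coeff y := by
  classical
  constructor
  · intro hf X hX x hx y hy
    induction hf using Submodule.span_induction with
    | mem f hf =>
      obtain ⟨Y, hY, rfl⟩ := hf
      have key : ∀ z ∈ X, z ∈ Y ↔ Y = X := fun z hz =>
        ⟨fun hzY => (hc.2 z).unique ⟨hY, hzY⟩ ⟨hX, hz⟩, fun e => e ▸ hz⟩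
      simp only [coeff_xi, key x hx, key y hy]
    | zero => simp
    | add f g _ _ hf hg => simp [hf, hg]
    | smul n f _ hf => simp [hf]
  · intro hf
    have hne : ∀ X ∈ c, X.Nonempty := fun X hX => Setoid.nonempty_of_mem_partition hc hX
    choose! rep hrep using hne
    have : f = ∑ X ∈ c.toFinite.toFinset, f.coeff (rep X) • xi X := by
      ext x
      obtain ⟨X, ⟨hX, hx⟩, huniq⟩ := hc.2 x
      rw [AddMonoidAlgebra.coeff_sum, Finsupp.finsetSum_apply, Finset.sum_eq_single X]
      · simp [coeff_xi, hx, hf X hX x hx _ (hrep X hX)]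
      · intro Y hY hne
        have : x ∉ Y := fun hxY => hne (huniq Y ⟨by simpa using hY, hxY⟩)
        simp [coeff_xi, this]
      · intro h
        exact absurd (by simpa using hX) h
    rw [this]
    exact Submodule.sum_mem _ fun X hX => Submodule.smul_mem _ _
      (Submodule.subset_span ⟨X, by simpa using hX, rfl⟩)

end Partition

/-! ### The partition into glued orbits and its Schur ring -/

section GluedOrbits

variable {R : Type*} [CommRing R] {p q : ℕ} {K₁ K₂ : Subgroup Rˣ}

theorem mem_orbit_subgroup_units {K : Subgroup Rˣ} {x y : R} :
    y ∈ MulAction.orbit K x ↔ ∃ w ∈ K, (w : R) * x = y := by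
  constructor
  · rintro ⟨w, rfl⟩
    exact ⟨w, w.2, rfl⟩
  · rintro ⟨w, hw, rfl⟩
    exact ⟨⟨w, hw⟩, rfl⟩

open Classical in
/-- The orbit of `x` under `K₁` if `x` is a unit and under `K₂` otherwise. -/
def gluedOrbit (K₁ K₂ : Subgroup Rˣ) (x : R) : Set R :=
  MulAction.orbit (if IsUnit x then K₁ else K₂ : Subgroup Rˣ) x

theorem gluedOrbit_of_isUnit {x : R} (hx : IsUnit x) :
    gluedOrbit K₁ K₂ x = MulAction.orbit K₁ x := by
  rw [gluedOrbit, if_pos hx]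

theorem gluedOrbit_of_not_isUnit {x : R} (hx : ¬ IsUnit x) :
    gluedOrbit K₁ K₂ x = MulAction.orbit K₂ x := by
  rw [gluedOrbit, if_neg hx]

theorem self_mem_gluedOrbit (x : R) : x ∈ gluedOrbit K₁ K₂ x :=
  MulAction.mem_orbit_self x

theorem exists_unit_of_mem_gluedOrbit {x y : R} (h : y ∈ gluedOrbit K₁ K₂ x) :
    ∃ w : Rˣ, (w : R) * x = y := by
  obtain ⟨w, _, hw⟩ := mem_orbit_subgroup_units.1 h
  exact ⟨w, hw⟩

theorem gluedOrbit_eq_of_mem {x y : R} (h : y ∈ gluedOrbit K₁ K₂ x) :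
    gluedOrbit K₁ K₂ y = gluedOrbit K₁ K₂ x := by
  obtain ⟨w, rfl⟩ := exists_unit_of_mem_gluedOrbit h
  by_cases hx : IsUnit x
  · rw [gluedOrbit_of_isUnit hx] at h ⊢
    rw [gluedOrbit_of_isUnit (w.isUnit.mul hx)]
    exact MulAction.orbit_eq_iff.2 h
  · rw [gluedOrbit_of_not_isUnit hx] at h ⊢
    rw [gluedOrbit_of_not_isUnit (by simpa using hx)]
    exact MulAction.orbit_eq_iff.2 h

theorem smul_gluedOrbit (u : Rˣ) (x : R) :
    u • gluedOrbit K₁ K₂ x = gluedOrbit K₁ K₂ (u * x) := by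
  have key : ∀ K : Subgroup Rˣ, u • MulAction.orbit K x = MulAction.orbit K ((u : R) * x) := by
    intro K
    ext y
    simp only [Set.mem_smul_set, mem_orbit_subgroup_units]
    constructor
    · rintro ⟨_, ⟨w, hw, rfl⟩, rfl⟩
      exact ⟨w, hw, by rw [Units.smul_def, smul_eq_mul]; ring⟩
    · rintro ⟨w, hw, rfl⟩
      exact ⟨_, ⟨w, hw, rfl⟩, by rw [Units.smul_def, smul_eq_mul]; ring⟩
  by_cases hx : IsUnit x
  · rw [gluedOrbit_of_isUnit hx, gluedOrbit_of_isUnit (u.isUnit.mul hx), key]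
  · rw [gluedOrbit_of_not_isUnit hx, gluedOrbit_of_not_isUnit (by simpa using hx), key]

theorem gluedOrbits_eq_range
    (h : ∀ x : R, x ∈ Ideal.span {(p : R)} ∨ x ∈ Ideal.span {(q : R)} ↔ ¬ IsUnit x) :
    gluedOrbits p q K₁ K₂ = Set.range (gluedOrbit K₁ K₂) := by
  ext X
  constructor
  · rintro (⟨x, hx, rfl⟩ | ⟨x, hx, rfl⟩)
    · exact ⟨x, gluedOrbit_of_isUnit hx⟩
    · exact ⟨x, gluedOrbit_of_not_isUnit ((h x).1 hx)⟩
  · rintro ⟨x, rfl⟩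
    by_cases hx : IsUnit x
    · exact .inl ⟨x, hx, (gluedOrbit_of_isUnit hx).symm⟩
    · exact .inr ⟨x, (h x).2 hx, (gluedOrbit_of_not_isUnit hx).symm⟩

theorem isPartition_range_gluedOrbit :
    Setoid.IsPartition (Set.range (gluedOrbit K₁ K₂)) := by
  refine ⟨?_, fun x => ⟨_, ⟨⟨x, rfl⟩, self_mem_gluedOrbit x⟩, ?_⟩⟩
  · rintro ⟨x, hx⟩
    exact Set.notMem_empty x (hx ▸ self_mem_gluedOrbit x)
  · rintro _ ⟨⟨y, rfl⟩, hy⟩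
    exact (gluedOrbit_eq_of_mem hy).symm

theorem forall_gluedOrbit_iff_isGlued (f : R → ℤ) :
    (∀ X ∈ Set.range (gluedOrbit K₁ K₂), ∀ x ∈ X, ∀ y ∈ X, f x = f y) ↔ IsGlued K₁ K₂ f := by
  constructor
  · intro h
    refine ⟨fun w hw x hx => ?_, fun w hw x hx => ?_⟩
    · refine h _ ⟨x, rfl⟩ _ ?_ _ (self_mem_gluedOrbit x)
      rw [gluedOrbit_of_isUnit hx, mem_orbit_subgroup_units]
      exact ⟨w, hw, rfl⟩
    · refine h _ ⟨x, rfl⟩ _ ?_ _ (self_mem_gluedOrbit x)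
      rw [gluedOrbit_of_not_isUnit hx, mem_orbit_subgroup_units]
      exact ⟨w, hw, rfl⟩
  · intro h
    have key : ∀ x, ∀ y ∈ gluedOrbit K₁ K₂ x, f y = f x := by
      intro x y hy
      by_cases hx : IsUnit x
      · rw [gluedOrbit_of_isUnit hx, mem_orbit_subgroup_units] at hy
        obtain ⟨w, hw, rfl⟩ := hy
        exact h.unit w hw x hx
      · rw [gluedOrbit_of_not_isUnit hx, mem_orbit_subgroup_units] at hy
        obtain ⟨w, hw, rfl⟩ := hy
        exact h.nonunit w hw x hx
    rintro _ ⟨z, rfl⟩ x hx y hy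
    rw [key z x hx, key z y hy]

theorem mem_span_xi_gluedOrbit_iff [Finite R] (f : AddMonoidAlgebra ℤ R) :
    f ∈ Submodule.span ℤ (xi '' Set.range (gluedOrbit K₁ K₂)) ↔ IsGlued K₁ K₂ f.coeff := by
  rw [mem_span_xi_iff isPartition_range_gluedOrbit, forall_gluedOrbit_iff_isGlued]

theorem gluedOrbit_zero : gluedOrbit K₁ K₂ (0 : R) = {0} := by
  refine Set.eq_singleton_iff_unique_mem.2 ⟨self_mem_gluedOrbit 0, fun y hy => ?_⟩
  obtain ⟨w, rfl⟩ := exists_unit_of_mem_gluedOrbit hy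
  exact mul_zero _

/-- The Schur ring whose basic sets are the orbits of `K₁` on the units and the orbits of `K₂` on
the non-units. -/
noncomputable def gluedSchurRing [Finite R] (K₁ K₂ : Subgroup Rˣ)
    (hconv : ∀ f g : R → ℤ, IsGlued K₁ K₂ f → IsGlued K₁ K₂ g → IsGlued K₁ K₂ (conv f g)) :
    SchurRingOver R where
  toSubring :=
    { (Submodule.span ℤ (xi '' Set.range (gluedOrbit K₁ K₂))).toAddSubgroup with
      mul_mem' := fun {a b} ha hb => by
        change a * b ∈ Submodule.span ℤ (xi '' Set.range (gluedOrbit K₁ K₂))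
        rw [mem_span_xi_gluedOrbit_iff,
          show (a * b).coeff = conv a.coeff b.coeff from
            funext (AddMonoidAlgebra.coeff_mul_eq_conv a b)]
        exact hconv _ _ ((mem_span_xi_gluedOrbit_iff a).1 ha) ((mem_span_xi_gluedOrbit_iff b).1 hb)
      one_mem' := Submodule.subset_span ⟨{0}, ⟨0, gluedOrbit_zero⟩, by
        rw [xi, Set.Finite.toFinset_singleton, Finset.sum_singleton, AddMonoidAlgebra.one_def]⟩ }
  basicSets := Set.range (gluedOrbit K₁ K₂)
  isPartition := isPartition_range_gluedOrbit
  zero_mem := ⟨0, gluedOrbit_zero⟩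
  neg_mem := by
    rintro _ ⟨x, rfl⟩
    refine ⟨((-1 : Rˣ) : R) * x, ?_⟩
    rw [← smul_gluedOrbit]
    ext y
    simp [Units.smul_def]
  coe_eq_span := rfl
  smul_mem := by
    rintro u _ ⟨x, rfl⟩
    exact ⟨_, (smul_gluedOrbit u x).symm⟩

theorem SchurRingOver.isDense_of_basicSets_eq [Finite R] (S : SchurRingOver R)
    (hS : S.basicSets = Set.range (gluedOrbit K₁ K₂)) : S.IsDense := by
  intro I
  refine ⟨{X | X ∈ S.basicSets ∧ X ⊆ I}, fun X hX => hX.1, ?_⟩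
  refine Set.Subset.antisymm (fun x hx => ?_) (Set.sUnion_subset fun X hX => hX.2)
  refine Set.mem_sUnion.2 ⟨gluedOrbit K₁ K₂ x, ⟨by rw [hS]; exact ⟨x, rfl⟩, fun y hy => ?_⟩, self_mem_gluedOrbit x⟩
  obtain ⟨w, rfl⟩ := exists_unit_of_mem_gluedOrbit hy
  exact I.mul_mem_left _ hx

theorem gluedOrbit_subset_compl {I : Ideal R} {x : R} (hx : x ∉ I) :
    gluedOrbit K₁ K₂ x ⊆ (I : Set R)ᶜ := by
  intro y hy hyI
  obtain ⟨w, rfl⟩ := exists_unit_of_mem_gluedOrbit hy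
  exact hx ((I.unit_mul_mem_iff_mem w.isUnit).1 hyI)

theorem add_mem_of_mem_lowerIdeal {X : Set R} {x z : R} (hz : z ∈ lowerIdeal X) (hx : x ∈ X) :
    x + z ∈ X := by
  rw [← show X + (lowerIdeal X : Set R) = X from (isGreatest_lowerIdeal X).1]
  exact Set.add_mem_add hx hz

end GluedOrbits

/-! ### Purity and generalized wreath products -/

theorem IsLocalRing.exists_mul_eq_generator {A : Type*} [CommRing A] [IsLocalRing A] {π : A}
    (hπ : maximalIdeal A = Ideal.span {π}) (hsq : π * π = 0) {z : A} (hz : z ≠ 0) :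
    ∃ c, c * z = π := by
  by_cases hu : IsUnit z
  · obtain ⟨u, rfl⟩ := hu
    exact ⟨π * (u⁻¹ : Aˣ), by simp⟩
  · obtain ⟨c, rfl⟩ := Ideal.mem_span_singleton'.1 (hπ ▸ (show z ∈ maximalIdeal A from hu))
    by_cases hc : IsUnit c
    · obtain ⟨u, rfl⟩ := hc
      exact ⟨(u⁻¹ : Aˣ), by simp⟩
    · obtain ⟨d, rfl⟩ := Ideal.mem_span_singleton'.1 (hπ ▸ (show c ∈ maximalIdeal A from hc))
      exact absurd (by rw [mul_assoc, hsq, mul_zero]) hz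

theorem IsLocalRing.mul_eq_zero_of_mem {A : Type*} [CommRing A] [IsLocalRing A] {π : A}
    (hπ : maximalIdeal A = Ideal.span {π}) (hsq : π * π = 0) :
    ∀ x ∈ maximalIdeal A, ∀ y ∈ maximalIdeal A, x * y = 0 := by
  intro x hx y hy
  rw [hπ, Ideal.mem_span_singleton'] at hx hy
  obtain ⟨a, rfl⟩ := hx
  obtain ⟨b, rfl⟩ := hy
  linear_combination a * b * hsq

namespace IsGluingPair

variable {A B : Type*} [CommRing A] [IsLocalRing A] [CommRing B] [IsLocalRing B]
  [Finite A] [Finite B] {K₀ K₁ K₂ : Subgroup (A × B)ˣ} {π : A} {ρ : B}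
  (hπ : maximalIdeal A = Ideal.span {π}) (hπ2 : π * π = 0) (hπ0 : π ≠ 0)
  (hρ : maximalIdeal B = Ideal.span {ρ}) (hρ2 : ρ * ρ = 0) (hρ0 : ρ ≠ 0)
  (h : IsGluingPair K₀ K₁ K₂)
  (S : SchurRingOver (A × B)) (hS : S.basicSets = Set.range (gluedOrbit K₁ K₂))

include hπ hπ0 h hS

/-- The basic set of 1 is the group `K₁` itself; containing the principal units of `A`, it is stable
under translation by rad(A) × 0. -/
theorem not_isPure : ¬ S.IsPure := by
  intro hpure
  have h1 := hpure (gluedOrbit K₁ K₂ 1) (hS ▸ ⟨1, rfl⟩) ⟨1, self_mem_gluedOrbit 1, isUnit_one⟩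
  have hle : radLeft A B ≤ lowerIdeal (gluedOrbit K₁ K₂ (1 : A × B)) := by
    refine (isGreatest_lowerIdeal _).2 (Set.Subset.antisymm ?_ fun x hx =>
      ⟨x, hx, 0, (radLeft A B).zero_mem, add_zero x⟩)
    rintro _ ⟨x, hx, z, ⟨hz1, hz2⟩, rfl⟩
    rw [gluedOrbit_of_isUnit isUnit_one, mem_orbit_subgroup_units] at hx ⊢
    obtain ⟨w, hw, rfl⟩ := hx
    rw [mul_one]
    obtain ⟨u, hu1, hu2⟩ := exists_unit_mul_eq_add (Prod.isUnit_iff.1 w.isUnit).1 hz1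
    have hz2 : z.2 = 0 := hz2
    refine ⟨MulEquiv.prodUnits.symm (u, 1) * w, mul_mem (h.mem₁ _ hu1 rfl) hw, ?_⟩
    rw [mul_one]
    exact Prod.ext hu2 (by simp [hz2, MulEquiv.prodUnits])
  have : ((π, 0) : A × B) ∈ radLeft A B := ⟨hπ ▸ Ideal.mem_span_singleton_self π, by simp⟩
  have := h1 ▸ hle this
  exact hπ0 (congrArg Prod.fst ((Submodule.mem_bot _).1 this))

include hπ2 hρ hρ2 hρ0
omit h

theorem not_isNontrivialGenWreath
    (h1 : ∃ v : Bˣ, (v : B) - 1 ∈ maximalIdeal B ∧ MulEquiv.prodUnits.symm (1, v) ∉ K₁)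
    (h2 : ∃ u : Aˣ, (u : A) - 1 ∈ maximalIdeal A ∧
      ∀ v : Bˣ, (v : B) - 1 ∈ maximalIdeal B → MulEquiv.prodUnits.symm (u, v) ∉ K₂) :
    ¬ S.IsNontrivialGenWreath := by
  rintro ⟨I, J, -, -, hI, hJ, hIJ⟩
  have key : ∀ x ∉ I, ∀ z ∈ J, x + z ∈ gluedOrbit K₁ K₂ x := fun x hx z hz =>
    add_mem_of_mem_lowerIdeal (hIJ _ (hS ▸ ⟨x, rfl⟩) (gluedOrbit_subset_compl hx) hz).1
      (self_mem_gluedOrbit x)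
  have hI1 : (1 : A × B) ∉ I := fun hc => hI ((Ideal.eq_top_iff_one I).2 hc)
  -- Otherwise `J` contains 0 × rad(B), and the orbit of 1 would give (1, v) ∈ `K₁` for every
  -- principal unit v.
  have hsnd : ∀ z ∈ J, z.2 = 0 := by
    intro z hz
    by_contra hne
    obtain ⟨c, hc⟩ := exists_mul_eq_generator hρ hρ2 hne
    obtain ⟨v, hv, hvK⟩ := h1
    rw [hρ, Ideal.mem_span_singleton'] at hv
    obtain ⟨b, hb⟩ := hv
    have hz' : ((0, v - 1) : A × B) ∈ J := by
      rw [show ((0, v - 1) : A × B) = (0, b * c) * z from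
        Prod.ext (by simp) (by simp [← hb, ← hc, mul_assoc])]
      exact J.mul_mem_left _ hz
    have := key 1 hI1 _ hz'
    rw [gluedOrbit_of_isUnit isUnit_one, mem_orbit_subgroup_units] at this
    obtain ⟨w, hw, hwe⟩ := this
    refine hvK ((show MulEquiv.prodUnits.symm (1, v) = w from ?_) ▸ hw)
    rw [mul_one] at hwe
    refine Units.ext (hwe.trans ?_).symm
    exact Prod.ext (by simp [MulEquiv.prodUnits]) (by simp [MulEquiv.prodUnits])
  have hπJ : ∀ x ∈ maximalIdeal A, ((x, 0) : A × B) ∈ J := by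
    obtain ⟨z, hz, hne⟩ := Submodule.exists_mem_ne_zero_of_ne_bot hJ
    have hz1 : z.1 ≠ 0 := fun hc => hne (Prod.ext hc (hsnd z hz))
    obtain ⟨c, hc⟩ := exists_mul_eq_generator hπ hπ2 hz1
    intro x hx
    rw [hπ, Ideal.mem_span_singleton'] at hx
    obtain ⟨a, rfl⟩ := hx
    rw [show ((a * π, 0) : A × B) = (a * c, 0) * z from
      Prod.ext (by simp [← hc, mul_assoc]) (by simp)]
    exact J.mul_mem_left _ hz
  have hρm : ¬ IsUnit ρ := (hρ ▸ Ideal.mem_span_singleton_self ρ : ρ ∈ maximalIdeal B)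
  -- Otherwise (u, ρ) lies in the `K₂`-orbit of (1, ρ). The unit moving one to the other is (u, v)
  -- with vρ = ρ, which forces v to be principal and contradicts the choice of `u`.
  have hmem : ((1, ρ) : A × B) ∈ I := by
    by_contra hx
    obtain ⟨u, hu, huK⟩ := h2
    have := key _ hx _ (hπJ _ hu)
    rw [gluedOrbit_of_not_isUnit fun hc => hρm (Prod.isUnit_iff.1 hc).2,
      mem_orbit_subgroup_units] at this
    obtain ⟨w, hw, hwe⟩ := this
    have e1 : w.1.1 = u := by simpa using congrArg Prod.fst hwe
    have e2 : w.1.2 * ρ = ρ := by simpa using congrArg Prod.snd hwe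
    have ew : MulEquiv.prodUnits.symm (u, (MulEquiv.prodUnits w).2) = w :=
      Units.ext (Prod.ext e1.symm rfl)
    refine huK (MulEquiv.prodUnits w).2 ?_ (ew ▸ hw)
    by_contra hc
    have hc : IsUnit (w.1.2 - 1) := not_not.1 hc
    exact hρ0 (hc.mul_right_eq_zero.1 (by rw [sub_mul, e2, one_mul, sub_self]))
  -- Multiplying (1, ρ) by (1, 0) puts (1, 0) in `I`, so (0, 1) cannot be there too. But no unit
  -- moves (0, 1) to (π, 1), although (π, 0) ∈ `J`.
  have hx : ((0, 1) : A × B) ∉ I := by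
    intro hc
    refine hI1 ?_
    have := add_mem (I.mul_mem_left (1, 0) hmem) hc
    rw [show (1 : A × B) = (1, 1) from rfl]
    simpa using this
  have := key _ hx _ (hπJ π (hπ ▸ Ideal.mem_span_singleton_self π))
  obtain ⟨w, hwe⟩ := exists_unit_of_mem_gluedOrbit this
  exact hπ0 (by simpa using (congrArg Prod.fst hwe).symm)

end IsGluingPair

/-! ### Galois rings of characteristic `p²` and their unit groups -/

theorem mem_principalUnits_iff {A : Type*} [CommRing A] [IsLocalRing A] {u : Aˣ} :
    u ∈ principalUnits A ↔ (u : A) - 1 ∈ maximalIdeal A := by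
  rw [principalUnits, MonoidHom.mem_ker, Units.ext_iff, ← residue_eq_zero_iff, map_sub, map_one,
    sub_eq_zero]
  rfl

theorem one_add_pow_of_mul_self_eq_zero {A : Type*} [CommRing A] {x : A} (hx : x * x = 0)
    (n : ℕ) : (1 + x) ^ n = 1 + n * x := by
  induction n with
  | zero => simp
  | succ n ih =>
    rw [pow_succ, ih]
    push_cast
    linear_combination (n : A) * hx

theorem eq_one_of_pow_eq_one_of_coprime {G : Type*} [Monoid G] {x : G} {m n : ℕ}
    (h : m.Coprime n) (hm : x ^ m = 1) (hn : x ^ n = 1) : x = 1 := by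
  rw [← orderOf_eq_one_iff, ← Nat.dvd_one, ← h.gcd_eq_one]
  exact Nat.dvd_gcd (orderOf_dvd_of_pow_eq_one hm) (orderOf_dvd_of_pow_eq_one hn)

/-- Some cyclic factor of the group has order divisible by `l`; project to it and reduce modulo `l`.
-/
theorem CommGroup.exists_surjective_zmod {G : Type*} [CommGroup G] [Finite G] {l : ℕ}
    (hl : l.Prime) (hG : l ∣ Nat.card G) :
    ∃ f : G →* Multiplicative (ZMod l), Function.Surjective f := by
  classical
  obtain ⟨ι, _, n, hn, ⟨e⟩⟩ := CommGroup.equiv_prod_multiplicative_zmod_of_finite G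
  rw [Nat.card_congr e.toEquiv, Nat.card_pi] at hG
  obtain ⟨i, -, hi⟩ := (hl.prime.dvd_finsetProd_iff _).1 hG
  have hi : l ∣ n i := by simpa [Nat.card_congr Multiplicative.toAdd] using hi
  refine ⟨((ZMod.castHom hi (ZMod l)).toAddMonoidHom.toMultiplicative.comp
    (Pi.evalMonoidHom _ i)).comp e.toMonoidHom, ?_⟩
  simp only [MonoidHom.coe_comp]
  refine (Function.Surjective.comp ?_ (Function.surjective_eval i)).comp e.surjective
  exact ZMod.ringHom_surjective (ZMod.castHom hi (ZMod l))

theorem map_eq_one_of_pow_eq_one {G : Type*} [Group G] {l m : ℕ}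
    (f : G →* Multiplicative (ZMod l)) (hlm : m.Coprime l) {x : G} (hx : x ^ m = 1) :
    f x = 1 := by
  refine eq_one_of_pow_eq_one_of_coprime hlm (by rw [← map_pow, hx, map_one]) ?_
  refine Multiplicative.toAdd.injective ?_
  rw [toAdd_pow, toAdd_one, nsmul_eq_mul, CharP.cast_eq_zero, zero_mul]

/-- `f` kills `T`, whose exponent is prime to `l`, so its restriction to `U` is already onto. -/
theorem exists_mem_right_map_eq {G : Type*} [CommGroup G] {T U : Subgroup G} {l m : ℕ}
    (f : (T ⊔ U : Subgroup G) →* Multiplicative (ZMod l)) (hf : Function.Surjective f)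
    (hlm : m.Coprime l) (hT : ∀ t ∈ T, t ^ m = 1) (c : Multiplicative (ZMod l)) :
    ∃ u, ∃ hu : u ∈ U, f ⟨u, Subgroup.mem_sup_right hu⟩ = c := by
  obtain ⟨⟨k, hk⟩, rfl⟩ := hf c
  obtain ⟨t, ht, u, hu, rfl⟩ := Subgroup.mem_sup.1 hk
  refine ⟨u, hu, ?_⟩
  rw [show (⟨t * u, hk⟩ : (T ⊔ U : Subgroup G)) =
    ⟨t, Subgroup.mem_sup_left ht⟩ * ⟨u, Subgroup.mem_sup_right hu⟩ from rfl, map_mul,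
    map_eq_one_of_pow_eq_one f hlm (x := ⟨t, _⟩) (Subtype.ext (hT t ht)), one_mul]

theorem Subgroup.pow_eq_one_of_card_eq {G : Type*} [Group G] {T : Subgroup G} {n : ℕ}
    (hT : Nat.card T = n) {t : G} (ht : t ∈ T) : t ^ n = 1 := by
  have := pow_card_eq_one' (x := (⟨t, ht⟩ : T))
  rw [hT] at this
  exact congrArg Subtype.val this

namespace IsGaloisRing

variable {A : Type*} [CommRing A] [Finite A] [IsLocalRing A] {p q d : ℕ}
  (hA : IsGaloisRing A p 2 d) (hp : p.Prime) (hq : q.Prime) (hpq : p ≠ q)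

include hA

theorem natCast_mul_self : (p : A) * p = 0 := by
  have := hA.charP
  have := CharP.cast_eq_zero A (p ^ 2)
  rwa [Nat.cast_pow, pow_two] at this

theorem natCast_mem : (p : A) ∈ maximalIdeal A :=
  hA.maximalIdeal_eq ▸ Ideal.mem_span_singleton_self _

include hp

theorem natCast_ne_zero : (p : A) ≠ 0 := by
  have := hA.charP
  rw [Ne, CharP.cast_eq_zero_iff A (p ^ 2)]
  intro hc
  nlinarith [Nat.le_of_dvd hp.pos hc, hp.two_le]

include hq hpq in
theorem isUnit_natCast : IsUnit (q : A) := by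
  by_contra hc
  have hc : (q : A) ∈ maximalIdeal A := hc
  have := Nat.isCoprime_iff_coprime.2 ((Nat.coprime_primes hp hq).2 hpq)
  obtain ⟨a, b, hab⟩ := this
  have e : (a : A) * p + b * q = 1 := by exact_mod_cast congrArg (Int.cast : ℤ → A) hab
  exact (Ideal.ne_top_iff_one _).1 (maximalIdeal.isMaximal A).ne_top
    (e ▸ add_mem (Ideal.mul_mem_left _ _ hA.natCast_mem) (Ideal.mul_mem_left _ _ hc))

omit hp in
theorem pow_eq_one_of_mem_principalUnits {u : Aˣ} (hu : u ∈ principalUnits A) : u ^ p = 1 := by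
  rw [mem_principalUnits_iff] at hu
  have hsq := IsLocalRing.mul_eq_zero_of_mem hA.maximalIdeal_eq hA.natCast_mul_self
  ext
  have := one_add_pow_of_mul_self_eq_zero (hsq _ hu _ hu) p
  rw [hsq _ hA.natCast_mem _ hu] at this
  simpa using this

theorem dvd_card_principalUnits : p ∣ Nat.card (principalUnits A) := by
  have := Fact.mk hp
  obtain ⟨u, hu, he⟩ := IsGluingPair.exists_unit_mul_eq_add (isUnit_one (M := A)) hA.natCast_mem
  have hu := mem_principalUnits_iff.2 hu
  have hne : u ≠ 1 := by
    rintro rfl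
    exact hA.natCast_ne_zero hp (by simpa using he)
  have h1 : orderOf (⟨u, hu⟩ : principalUnits A) = p :=
    orderOf_eq_prime (Subtype.ext (hA.pow_eq_one_of_mem_principalUnits hu))
      fun hc => hne (congrArg Subtype.val hc)
  exact h1 ▸ orderOf_dvd_natCard _

include hq hpq

/-- Reduction to the residue field is injective on q-th roots of unity, because its kernel consists
of principal units, which are killed by p. -/
theorem card_rootsOfUnity_le : Nat.card (rootsOfUnity q A) ≤ q := by
  have : NeZero q := ⟨hq.ne_zero⟩
  have : Finite (rootsOfUnity q (ResidueField A)) := inferInstance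
  refine le_trans (Nat.card_le_card_of_injective
    (restrictRootsOfUnity (residue A) q) ?_) (card_rootsOfUnity (ResidueField A) q)
  rw [injective_iff_map_eq_one]
  rintro ⟨t, ht⟩ h
  have htU : t ∈ principalUnits A := by
    rw [principalUnits, MonoidHom.mem_ker]
    exact Units.ext (congrArg (fun x : rootsOfUnity q (ResidueField A) => (x.1 : ResidueField A)) h)
  exact Subtype.ext (eq_one_of_pow_eq_one_of_coprime ((Nat.coprime_primes hp hq).2 hpq)
    (hA.pow_eq_one_of_mem_principalUnits htU) ht)

theorem eq_rootsOfUnity_of_card_eq {T : Subgroup Aˣ} (hT : Nat.card T = q) :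
    T = rootsOfUnity q A :=
  Subgroup.eq_of_le_of_card_ge (fun _ ht => T.pow_eq_one_of_card_eq hT ht)
    ((hA.card_rootsOfUnity_le hp hq hpq).trans hT.ge)

theorem existsUnique_subgroup_card_eq (hqd : q ∣ p ^ d - 1) :
    ∃! T : Subgroup Aˣ, T ≤ teichmullerGroup A ∧ Nat.card T = q := by
  have := Fact.mk hq
  have hk : Nat.card (ResidueField A)ˣ = p ^ d - 1 := by
    rw [Nat.card_units, hA.card_residueField]
  have hdvd : q ∣ Nat.card Aˣ := (hk ▸ hqd).trans (Subgroup.card_dvd_of_surjective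
    (Units.map (residue A : A →* ResidueField A)) (surjective_units_map_of_local_ringHom _
      residue_surjective inferInstance))
  obtain ⟨g, hg⟩ := exists_prime_orderOf_dvd_card' q hdvd
  refine ⟨Subgroup.zpowers g, ⟨?_, by rw [Nat.card_zpowers, hg]⟩, fun T hT =>
    (hA.eq_rootsOfUnity_of_card_eq hp hq hpq hT.2).trans
      (hA.eq_rootsOfUnity_of_card_eq hp hq hpq (by rw [Nat.card_zpowers, hg])).symm⟩
  rw [Subgroup.zpowers_le, teichmullerGroup, mem_rootsOfUnity, hA.card_residueField,
    ← orderOf_dvd_iff_pow_eq_one, hg]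
  exact hqd

end IsGaloisRing

/-! ### Subdirect products -/

/-- The subdirect product of `K₁` and `K₂` defined by two homomorphisms to the same group. -/
def subdirectProduct {A B M : Type*} [CommRing A] [CommRing B] [Group M] {K₁ : Subgroup Aˣ}
    {K₂ : Subgroup Bˣ} (f₁ : K₁ →* M) (f₂ : K₂ →* M) : Subgroup (A × B)ˣ where
  carrier := {w | ∃ (hu : (MulEquiv.prodUnits w).1 ∈ K₁) (hv : (MulEquiv.prodUnits w).2 ∈ K₂),
    f₁ ⟨_, hu⟩ = f₂ ⟨_, hv⟩}
  one_mem' := ⟨one_mem K₁, one_mem K₂, (map_one f₁).trans (map_one f₂).symm⟩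
  mul_mem' := by
    rintro w v ⟨hu, hv, h⟩ ⟨hu', hv', h'⟩
    refine ⟨mul_mem hu hu', mul_mem hv hv', ?_⟩
    exact (map_mul f₁ ⟨_, hu⟩ ⟨_, hu'⟩).trans
      ((congrArg₂ (· * ·) h h').trans (map_mul f₂ ⟨_, hv⟩ ⟨_, hv'⟩).symm)
  inv_mem' := by
    rintro w ⟨hu, hv, h⟩
    exact ⟨inv_mem hu, inv_mem hv, (map_inv f₁ ⟨_, hu⟩).trans
      ((congrArg (·⁻¹) h).trans (map_inv f₂ ⟨_, hv⟩).symm)⟩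

theorem exists_isSubdirectOver {A B : Type*} [CommRing A] [CommRing B] [Finite A] [Finite B]
    {K₁ : Subgroup Aˣ} {K₂ : Subgroup Bˣ} {l : ℕ} (hl : l.Prime) (h₁ : l ∣ Nat.card K₁)
    (h₂ : l ∣ Nat.card K₂) : ∃ L, IsSubdirectOver l K₁ K₂ L := by
  obtain ⟨f₁, hf₁⟩ := CommGroup.exists_surjective_zmod hl h₁
  obtain ⟨f₂, hf₂⟩ := CommGroup.exists_surjective_zmod hl h₂
  exact ⟨subdirectProduct f₁ f₂, f₁, f₂, hf₁, hf₂, fun w => Iff.rfl⟩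

theorem mul_sub_mem_of_mem_principalUnits {R : Type*} [CommRing R] [IsLocalRing R] (a : Rˣ)
    {u : Rˣ} (hu : u ∈ principalUnits R) : ((a * u : Rˣ) : R) - a ∈ maximalIdeal R := by
  rw [show ((a * u : Rˣ) : R) - a = a * (u - 1) by rw [Units.val_mul]; ring]
  exact Ideal.mul_mem_left _ _ (mem_principalUnits_iff.1 hu)

section

variable {A B : Type*} [CommRing A] [IsLocalRing A] [CommRing B] [IsLocalRing B] {p q : ℕ}
  {T : Subgroup Aˣ} {T' : Subgroup Bˣ} {K₁ K₂ : Subgroup (A × B)ˣ}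
  (hpq : p.Coprime q)
  (hT : ∀ t ∈ T, t ^ q = 1) (hT' : ∀ t ∈ T', t ^ p = 1)
  (hU : ∀ u ∈ principalUnits A, u ^ p = 1) (hU' : ∀ u ∈ principalUnits B, u ^ q = 1)

include hpq hT hT' hU hU'

/-- Coprimality kills principal units of `A` under `f₁` and those of `B` under `g₂`. Surjectivity of
`f₁` and `g₂` gives the lifts; the approximations hold because `f₂` and `g₁` remain onto on
principal units. -/
theorem IsSubdirectOver.isGluingPair
    (h₁ : IsSubdirectOver q (T ⊔ principalUnits A) (T' ⊔ principalUnits B) K₁)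
    (h₂ : IsSubdirectOver p (T ⊔ principalUnits A) (T' ⊔ principalUnits B) K₂) :
    IsGluingPair (((T ⊔ principalUnits A).prod (T' ⊔ principalUnits B)).comap
      (MulEquiv.prodUnits : (A × B)ˣ ≃* Aˣ × Bˣ).toMonoidHom) K₁ K₂ := by
  obtain ⟨f₁, f₂, hf₁, hf₂, hf⟩ := h₁
  obtain ⟨g₁, g₂, hg₁, hg₂, hg⟩ := h₂
  refine ⟨?_, ?_, ?_, ?_, ?_, ?_, ?_, ?_⟩
  · intro w hw
    obtain ⟨hu, hv, -⟩ := (hf w).1 hw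
    exact ⟨hu, hv⟩
  · intro w hw
    obtain ⟨hu, hv, -⟩ := (hg w).1 hw
    exact ⟨hu, hv⟩
  · intro w hw1 hw2
    have hu : (MulEquiv.prodUnits w).1 ∈ principalUnits A := mem_principalUnits_iff.2 hw1
    have e : (MulEquiv.prodUnits w).2 = 1 := Units.ext hw2
    refine (hf w).2 ⟨Subgroup.mem_sup_right hu, e ▸ one_mem _, ?_⟩
    rw [map_eq_one_of_pow_eq_one f₁ hpq (Subtype.ext (hU _ hu))]
    simp only [e]
    exact (map_one f₂).symm
  · intro w hw1 hw2
    have hv : (MulEquiv.prodUnits w).2 ∈ principalUnits B := mem_principalUnits_iff.2 hw2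
    have e : (MulEquiv.prodUnits w).1 = 1 := Units.ext hw1
    refine (hg w).2 ⟨e ▸ one_mem _, Subgroup.mem_sup_right hv, ?_⟩
    rw [map_eq_one_of_pow_eq_one g₂ hpq.symm (Subtype.ext (hU' _ hv))]
    simp only [e]
    exact map_one g₁
  · rintro w ⟨-, hv⟩
    obtain ⟨⟨u, hu⟩, he⟩ := hf₁ (f₂ ⟨_, hv⟩)
    exact ⟨MulEquiv.prodUnits.symm (u, (MulEquiv.prodUnits w).2), (hf _).2 ⟨hu, hv, he⟩, rfl⟩
  · rintro w ⟨hu, -⟩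
    obtain ⟨⟨v, hv⟩, he⟩ := hg₂ (g₁ ⟨_, hu⟩)
    exact ⟨MulEquiv.prodUnits.symm ((MulEquiv.prodUnits w).1, v), (hg _).2 ⟨hu, hv, he.symm⟩, rfl⟩
  · rintro w ⟨hu, hv⟩
    -- The principal unit `y` corrects the mismatch between the two images of `w` without changing
    -- residues.
    obtain ⟨y, hy, he⟩ := exists_mem_right_map_eq f₂ hf₂ hpq hT' ((f₂ ⟨_, hv⟩)⁻¹ * f₁ ⟨_, hu⟩)
    refine ⟨MulEquiv.prodUnits.symm ((MulEquiv.prodUnits w).1, (MulEquiv.prodUnits w).2 * y),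
      (hf _).2 ⟨hu, mul_mem hv (Subgroup.mem_sup_right hy), ?_⟩, rfl, mul_sub_mem_of_mem_principalUnits _ hy⟩
    refine Eq.trans ?_ (map_mul f₂ ⟨_, hv⟩ ⟨y, Subgroup.mem_sup_right hy⟩).symm
    rw [he, mul_inv_cancel_left]
    rfl
  · rintro w ⟨hu, hv⟩
    obtain ⟨y, hy, he⟩ := exists_mem_right_map_eq g₁ hg₁ hpq.symm hT
      ((g₁ ⟨_, hu⟩)⁻¹ * g₂ ⟨_, hv⟩)
    refine ⟨MulEquiv.prodUnits.symm ((MulEquiv.prodUnits w).1 * y, (MulEquiv.prodUnits w).2),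
      (hg _).2 ⟨mul_mem hu (Subgroup.mem_sup_right hy), hv, ?_⟩, mul_sub_mem_of_mem_principalUnits _ hy, rfl⟩
    refine (map_mul g₁ ⟨_, hu⟩ ⟨y, Subgroup.mem_sup_right hy⟩).trans ?_
    rw [he, mul_inv_cancel_left]
    rfl

omit hT hU hU' in
theorem IsSubdirectOver.exists_right_notMem (hq : q.Prime)
    (h₁ : IsSubdirectOver q (T ⊔ principalUnits A) (T' ⊔ principalUnits B) K₁) :
    ∃ v : Bˣ, (v : B) - 1 ∈ maximalIdeal B ∧ MulEquiv.prodUnits.symm (1, v) ∉ K₁ := by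
  obtain ⟨f₁, f₂, hf₁, hf₂, hf⟩ := h₁
  have := Fact.mk hq
  obtain ⟨c, hc⟩ := exists_ne (1 : Multiplicative (ZMod q))
  obtain ⟨v, hv, he⟩ := exists_mem_right_map_eq f₂ hf₂ hpq hT' c
  refine ⟨v, mem_principalUnits_iff.1 hv, fun hw => ?_⟩
  obtain ⟨_, _, e⟩ := (hf _).1 hw
  exact hc (he.symm.trans (e.symm.trans (map_one f₁)))

omit hT' hU in
theorem IsSubdirectOver.exists_left_notMem (hp : p.Prime)
    (h₂ : IsSubdirectOver p (T ⊔ principalUnits A) (T' ⊔ principalUnits B) K₂) :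
    ∃ u : Aˣ, (u : A) - 1 ∈ maximalIdeal A ∧
      ∀ v : Bˣ, (v : B) - 1 ∈ maximalIdeal B → MulEquiv.prodUnits.symm (u, v) ∉ K₂ := by
  obtain ⟨g₁, g₂, hg₁, hg₂, hg⟩ := h₂
  have := Fact.mk hp
  obtain ⟨c, hc⟩ := exists_ne (1 : Multiplicative (ZMod p))
  obtain ⟨u, hu, he⟩ := exists_mem_right_map_eq g₁ hg₁ hpq.symm hT c
  refine ⟨u, mem_principalUnits_iff.1 hu, fun v hv hw => ?_⟩
  obtain ⟨_, hv', e⟩ := (hg _).1 hw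
  refine hc (he.symm.trans (e.trans ?_))
  exact map_eq_one_of_pow_eq_one g₂ hpq.symm
    (Subtype.ext (hU' _ (mem_principalUnits_iff.2 hv)))

end

/-! ### Non-units of the product ring, and the theorem -/

/-- As p is invertible in `B` and q in `A`, the ideals pR and qR are rad(A) × B and A × rad(B). -/
theorem IsGaloisRing.mem_span_or_mem_span_iff {A B : Type*} [CommRing A] [Finite A]
    [IsLocalRing A] [CommRing B] [Finite B] [IsLocalRing B] {p q d e : ℕ} (hp : p.Prime)
    (hq : q.Prime) (hpq : p ≠ q) (hA : IsGaloisRing A p 2 d) (hB : IsGaloisRing B q 2 e)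
    (x : A × B) : x ∈ Ideal.span {((p : ℕ) : A × B)} ∨ x ∈ Ideal.span {((q : ℕ) : A × B)} ↔
      ¬ IsUnit x := by
  have h1 : x ∈ Ideal.span {((p : ℕ) : A × B)} ↔ ¬ IsUnit x.1 := by
    rw [← mem_nonunits_iff, ← mem_maximalIdeal, hA.maximalIdeal_eq, Ideal.mem_span_singleton',
      Ideal.mem_span_singleton']
    constructor
    · rintro ⟨c, rfl⟩
      exact ⟨c.1, rfl⟩
    · rintro ⟨a, ha⟩
      obtain ⟨u, hu⟩ := hB.isUnit_natCast hq hp hpq.symm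
      exact ⟨(a, x.2 * (u⁻¹ : Bˣ)), Prod.ext ha (by simp [← hu])⟩
  have h2 : x ∈ Ideal.span {((q : ℕ) : A × B)} ↔ ¬ IsUnit x.2 := by
    rw [← mem_nonunits_iff, ← mem_maximalIdeal, hB.maximalIdeal_eq, Ideal.mem_span_singleton',
      Ideal.mem_span_singleton']
    constructor
    · rintro ⟨c, rfl⟩
      exact ⟨c.2, rfl⟩
    · rintro ⟨a, ha⟩
      obtain ⟨u, hu⟩ := hA.isUnit_natCast hp hq hpq
      exact ⟨(x.1 * (u⁻¹ : Aˣ), a), Prod.ext (by simp [← hu]) ha⟩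
  rw [h1, h2, Prod.isUnit_iff, not_and_or]

theorem mainTheorem2 {Rp Rq : Type*} [CommRing Rp] [Finite Rp] [IsLocalRing Rp]
    [CommRing Rq] [Finite Rq] [IsLocalRing Rq] (p q d e : ℕ)
    (hp : p.Prime) (hq : q.Prime) (hpq : p ≠ q) (hd : 0 < d) (he : 0 < e)
    (hpe : p ∣ q ^ e - 1) (hqd : q ∣ p ^ d - 1)
    (hRp : IsGaloisRing Rp p 2 d) (hRq : IsGaloisRing Rq q 2 e) :
    (∃ A : SchurRingOver (Rp × Rq), A.IsDense ∧ ¬ A.IsPure ∧ ¬ A.IsNontrivialGenWreath) ∧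
    (∃! Tp : Subgroup Rpˣ, Tp ≤ teichmullerGroup Rp ∧ Nat.card Tp = q) ∧
    (∃! Tq : Subgroup Rqˣ, Tq ≤ teichmullerGroup Rq ∧ Nat.card Tq = p) ∧
    ∀ (Tp : Subgroup Rpˣ) (Tq : Subgroup Rqˣ),
      Tp ≤ teichmullerGroup Rp → Nat.card Tp = q →
      Tq ≤ teichmullerGroup Rq → Nat.card Tq = p →
      (∃ K₁, IsSubdirectOver q (Tp ⊔ principalUnits Rp) (Tq ⊔ principalUnits Rq) K₁) ∧
      (∃ K₂, IsSubdirectOver p (Tp ⊔ principalUnits Rp) (Tq ⊔ principalUnits Rq) K₂) ∧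
      ∀ K₁ K₂ : Subgroup (Rp × Rq)ˣ,
        IsSubdirectOver q (Tp ⊔ principalUnits Rp) (Tq ⊔ principalUnits Rq) K₁ →
        IsSubdirectOver p (Tp ⊔ principalUnits Rp) (Tq ⊔ principalUnits Rq) K₂ →
        ∃ A : SchurRingOver (Rp × Rq),
          A.basicSets = gluedOrbits p q K₁ K₂ ∧
          (A.toSubring : Set (AddMonoidAlgebra ℤ (Rp × Rq))) =
            Submodule.span ℤ (xi '' gluedOrbits p q K₁ K₂) ∧
          A.IsDense ∧ ¬ A.IsPure ∧ ¬ A.IsNontrivialGenWreath := by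
  have hTp := hRp.existsUnique_subgroup_card_eq hp hq hpq hqd
  have hTq := hRq.existsUnique_subgroup_card_eq hq hp hpq.symm hpe
  have main : ∀ (Tp : Subgroup Rpˣ) (Tq : Subgroup Rqˣ),
      Tp ≤ teichmullerGroup Rp → Nat.card Tp = q →
      Tq ≤ teichmullerGroup Rq → Nat.card Tq = p →
      (∃ K₁, IsSubdirectOver q (Tp ⊔ principalUnits Rp) (Tq ⊔ principalUnits Rq) K₁) ∧
      (∃ K₂, IsSubdirectOver p (Tp ⊔ principalUnits Rp) (Tq ⊔ principalUnits Rq) K₂) ∧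
      ∀ K₁ K₂ : Subgroup (Rp × Rq)ˣ,
        IsSubdirectOver q (Tp ⊔ principalUnits Rp) (Tq ⊔ principalUnits Rq) K₁ →
        IsSubdirectOver p (Tp ⊔ principalUnits Rp) (Tq ⊔ principalUnits Rq) K₂ →
        ∃ A : SchurRingOver (Rp × Rq),
          A.basicSets = gluedOrbits p q K₁ K₂ ∧
          (A.toSubring : Set (AddMonoidAlgebra ℤ (Rp × Rq))) =
            Submodule.span ℤ (xi '' gluedOrbits p q K₁ K₂) ∧
          A.IsDense ∧ ¬ A.IsPure ∧ ¬ A.IsNontrivialGenWreath := by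
    intro Tp Tq _ hcp _ hcq
    have hp1 : p ∣ Nat.card (Tp ⊔ principalUnits Rp : Subgroup Rpˣ) :=
      (hRp.dvd_card_principalUnits hp).trans (Subgroup.card_dvd_of_le le_sup_right)
    have hp2 : q ∣ Nat.card (Tp ⊔ principalUnits Rp : Subgroup Rpˣ) :=
      (dvd_of_eq hcp.symm).trans (Subgroup.card_dvd_of_le le_sup_left)
    have hq1 : q ∣ Nat.card (Tq ⊔ principalUnits Rq : Subgroup Rqˣ) :=
      (hRq.dvd_card_principalUnits hq).trans (Subgroup.card_dvd_of_le le_sup_right)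
    have hq2 : p ∣ Nat.card (Tq ⊔ principalUnits Rq : Subgroup Rqˣ) :=
      (dvd_of_eq hcq.symm).trans (Subgroup.card_dvd_of_le le_sup_left)
    refine ⟨exists_isSubdirectOver hq hp2 hq1, exists_isSubdirectOver hp hp1 hq2,
      fun K₁ K₂ hK₁ hK₂ => ?_⟩
    have hcop : p.Coprime q := (Nat.coprime_primes hp hq).2 hpq
    have hT : ∀ t ∈ Tp, t ^ q = 1 := fun t ht => Tp.pow_eq_one_of_card_eq hcp ht
    have hT' : ∀ t ∈ Tq, t ^ p = 1 := fun t ht => Tq.pow_eq_one_of_card_eq hcq ht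
    have hU : ∀ u ∈ principalUnits Rp, u ^ p = 1 := fun u hu =>
      hRp.pow_eq_one_of_mem_principalUnits hu
    have hU' : ∀ u ∈ principalUnits Rq, u ^ q = 1 := fun u hu =>
      hRq.pow_eq_one_of_mem_principalUnits hu
    have hpair := IsSubdirectOver.isGluingPair hcop hT hT' hU hU' hK₁ hK₂
    have horb : gluedOrbits p q K₁ K₂ = Set.range (gluedOrbit K₁ K₂) :=
      gluedOrbits_eq_range (hRp.mem_span_or_mem_span_iff hp hq hpq hRq)
    rw [horb]
    refine ⟨gluedSchurRing K₁ K₂ fun f g hf hg => hpair.isGlued_conv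
        (IsLocalRing.mul_eq_zero_of_mem hRp.maximalIdeal_eq hRp.natCast_mul_self)
        (IsLocalRing.mul_eq_zero_of_mem hRq.maximalIdeal_eq hRq.natCast_mul_self) hf hg,
      rfl, rfl, SchurRingOver.isDense_of_basicSets_eq _ rfl,
      hpair.not_isPure hRp.maximalIdeal_eq (hRp.natCast_ne_zero hp) _ rfl,
      IsGluingPair.not_isNontrivialGenWreath hRp.maximalIdeal_eq hRp.natCast_mul_self
        (hRp.natCast_ne_zero hp) hRq.maximalIdeal_eq hRq.natCast_mul_self
        (hRq.natCast_ne_zero hq) _ rfl (hK₁.exists_right_notMem hcop hT' hq)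
        (hK₂.exists_left_notMem hcop hT hU' hp)⟩
  refine ⟨?_, hTp, hTq, main⟩
  obtain ⟨Tp, hTp, hcp⟩ := hTp.exists
  obtain ⟨Tq, hTq, hcq⟩ := hTq.exists
  obtain ⟨⟨K₁, hK₁⟩, ⟨K₂, hK₂⟩, h⟩ := main Tp Tq hTp hcp hTq hcq
  obtain ⟨S, -, -, hS⟩ := h K₁ K₂ hK₁ hK₂
  exact ⟨S, hS⟩
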